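/- Let $T$ be a triangulated surface (a connected $2$-manifold, possibly with boundary) that is a simplicial complex, with vertex set $V$ and edge set $E$, and let $\ell:E\to\mathbb{R}_{>0}$ be a discrete metric, i.e. $\ell$ satisfies the strict triangle inequalities in every triangle, so that $(T,\ell)$ is a surface glued edge-to-edge from euclidean triangles. Regard the interior of the circumcircle of each triangle as a hyperbolic plane (curvature $-1$) in the Klein model. The triangles of $(T,\ell)$ become ideal hyperbolic triangles, and, since the hyperbolic distances induced on a common edge by its two triangles agree, $T\setminus V$ becomes a hyperbolic surface with cusps with an ideal triangulation. Let $ij$ be an interior edge between the triangles $ijk$ and $ilj$, where the order of the labels fixes a local orientation. Let $a$ and $b$ be the base points on the edge $ij$ of the hyperbolic heights of these ideal triangles from the opposite vertices $k$ and $l$, respectively. The shear coordinate $Z_{ij}$ is the signed hyperbolic distance from $a$ to $b$ along the edge, counted positively in the direction from $i$ to $j$. Then $$Z_{ij}=\log\operatorname{lcr}_{ij},\qquad \operatorname{lcr}_{ij}=\frac{\ell_{il}\,\ell_{jk}}{\ell_{lj}\,\ell_{ki}}.$$ Moreover, one can choose in each ideal triangle a horocycle centered at each of its vertices such that the horocycles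 in triangles with a common edge meet this edge in the same points, and such that the Penner coordinates of the resulting decorated ideal triangulation are $\lambda_{ij}=2\log\ell_{ij}$ for every edge $ij\in E$. Here the Penner coordinate $\lambda_{ij}$ is the signed hyperbolic distance, along the edge $ij$, between the horocycles centered at $i$ and $j$, taken negatively if the horocycles overlap. -/

import Mathlib

noncomputable section

/-! ### Surface triangulations, discrete metrics, length-cross-ratios -/

/-- A triangulated surface (connected, possibly with boundary, not necessarily compact or
orientable) that is a simplicial complex, given by the vertex sets of its triangles.  The last
conditions say that every edge lies in at most two triangles and that the link of every vertex is
finite and connected (hence a cycle or a path), and that the surface is connected. -/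
structure SurfaceTriangulation (V : Type*) [DecidableEq V] where
  triangles : Set (Finset V)
  nonempty : triangles.Nonempty
  card_eq : ∀ t ∈ triangles, t.card = 3
  vertex_mem : ∀ v : V, ∃ t ∈ triangles, v ∈ t
  edge_le_two : ∀ i j : V, i ≠ j → {t ∈ triangles | i ∈ t ∧ j ∈ t}.encard ≤ 2
  star_finite : ∀ v : V, {t ∈ triangles | v ∈ t}.Finite
  link_connected : ∀ v : V, ∀ t ∈ triangles, ∀ t' ∈ triangles, v ∈ t → v ∈ t' →
    Relation.ReflTransGen
      (fun a b : Finset V => a ∈ triangles ∧ b ∈ triangles ∧ v ∈ a ∧ v ∈ b ∧ 2 ≤ (a ∩ b).card) t t'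
  connected : ∀ t ∈ triangles, ∀ t' ∈ triangles,
    Relation.ReflTransGen
      (fun a b : Finset V => a ∈ triangles ∧ b ∈ triangles ∧ (a ∩ b).Nonempty) t t'

/-- The type of triangles of a triangulation. -/
abbrev SurfaceTriangulation.Face {V : Type*} [DecidableEq V] (T : SurfaceTriangulation V) :
    Type _ :=
  {t : Finset V // t ∈ T.triangles}

/-- A discrete metric: positive edge lengths satisfying the strict triangle inequalities in every
triangle.  Only the values of `len` on edges of the triangulation are meaningful. -/
structure DiscreteMetric {V : Type*} [DecidableEq V] (T : SurfaceTriangulation V) where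
  len : Sym2 V → ℝ
  len_pos : ∀ t ∈ T.triangles, ∀ i ∈ t, ∀ j ∈ t, i ≠ j → 0 < len s(i, j)
  triangle_ineq : ∀ i j k : V, {i, j, k} ∈ T.triangles →
    len s(i, j) < len s(i, k) + len s(k, j)

/-- The length-cross-ratio of the interior edge `ij` between the triangles `ijk` and `ilj`. -/
def DiscreteMetric.lcr {V : Type*} [DecidableEq V] {T : SurfaceTriangulation V}
    (ℓ : DiscreteMetric T) (i j k l : V) : ℝ :=
  (ℓ.len s(i, l) * ℓ.len s(j, k)) / (ℓ.len s(l, j) * ℓ.len s(k, i))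

/-! ### The Klein model in the interior of a circle -/

/-- The euclidean plane. -/
abbrev Plane : Type := EuclideanSpace ℝ (Fin 2)

/-- A circle in the euclidean plane. -/
abbrev Circ : Type := EuclideanGeometry.Sphere Plane

/-- The hyperbolic plane, in the Klein model: the open disk bounded by the circle `S`. -/
def kleinDisk (S : Circ) : Set Plane := Metric.ball S.center S.radius

/-- The hyperbolic distance (curvature `-1`) of two points of the Klein disk. -/
def kleinDist (S : Circ) (x y : Plane) : ℝ :=
  Real.arcosh ((S.radius ^ 2 - inner ℝ (x - S.center) (y - S.center)) /
    (Real.sqrt (S.radius ^ 2 - ‖x - S.center‖ ^ 2) *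
      Real.sqrt (S.radius ^ 2 - ‖y - S.center‖ ^ 2)))

/-- The hyperbolic Riemannian metric of the Klein disk at the point `x`. -/
def kleinMetric (S : Circ) (x u w : Plane) : ℝ :=
  inner ℝ u w / (S.radius ^ 2 - ‖x - S.center‖ ^ 2) +
    inner ℝ (x - S.center) u * inner ℝ (x - S.center) w /
      (S.radius ^ 2 - ‖x - S.center‖ ^ 2) ^ 2

/-- The horocycle centered at the ideal point `v` that passes through `x₀`: the level set through
`x₀` of the Busemann function at `v`. -/
def horocycle (S : Circ) (v x₀ : Plane) : Set Plane :=
  {x ∈ kleinDisk S | Filter.Tendsto (fun y => kleinDist S x y - kleinDist S x₀ y)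
    (nhdsWithin v (kleinDisk S)) (nhds 0)}

/-- `H` is a horocycle centered at the ideal point `v`. -/
def IsHorocycle (S : Circ) (v : Plane) (H : Set Plane) : Prop :=
  ∃ x₀ ∈ kleinDisk S, H = horocycle S v x₀

/-- The signed distance from `x` to `y`, for two points of a hyperbolic line of which `p` is one
of the two ideal endpoints; the line is directed away from `p`. -/
def signedKleinDist (S : Circ) (p x y : Plane) : ℝ :=
  if dist p x ≤ dist p y then kleinDist S x y else -kleinDist S x y

/-- `a` is the base point, on the side `pq`, of the height from `v` of the ideal triangle with
vertices `p`, `q`, `v`: the hyperbolic line through `v` and `a` is orthogonal to `pq`. -/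
def IsHeightFoot (S : Circ) (v p q a : Plane) : Prop :=
  a ∈ openSegment ℝ p q ∧ kleinMetric S a (v - a) (q - p) = 0

/-! ### Ideal triangulations, shear coordinates, horocycles, Penner coordinates -/

/-- A hyperbolic surface with an ideal triangulation with the combinatorics of `T`: every triangle
is an ideal triangle in a Klein disk, and triangles with a common edge `ij` are glued along it by
isometries of their sides (which are complete hyperbolic lines) that match the ends labeled `i`
and the ends labeled `j`. -/
structure IdealTriangulation {V : Type*} [DecidableEq V] (T : SurfaceTriangulation V) where
  circle : T.Face → Circ
  vertex : T.Face → V → Plane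
  glue : T.Face → T.Face → V → V → Plane → Plane
  vertex_mem : ∀ t : T.Face, ∀ i ∈ t.1, vertex t i ∈ circle t
  vertex_injOn : ∀ t : T.Face, Set.InjOn (vertex t) t.1
  glue_mapsTo : ∀ t t' : T.Face, t ≠ t' → ∀ i ∈ t.1 ∩ t'.1, ∀ j ∈ t.1 ∩ t'.1, i ≠ j →
    Set.MapsTo (glue t t' i j) (openSegment ℝ (vertex t i) (vertex t j))
      (openSegment ℝ (vertex t' i) (vertex t' j))
  glue_inv : ∀ t t' : T.Face, t ≠ t' → ∀ i ∈ t.1 ∩ t'.1, ∀ j ∈ t.1 ∩ t'.1, i ≠ j →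
    ∀ x ∈ openSegment ℝ (vertex t i) (vertex t j), glue t' t i j (glue t t' i j x) = x
  glue_swap : ∀ t t' : T.Face, t ≠ t' → ∀ i ∈ t.1 ∩ t'.1, ∀ j ∈ t.1 ∩ t'.1, i ≠ j →
    ∀ x ∈ openSegment ℝ (vertex t i) (vertex t j), glue t t' j i x = glue t t' i j x
  glue_signedKleinDist : ∀ t t' : T.Face, t ≠ t' → ∀ i ∈ t.1 ∩ t'.1, ∀ j ∈ t.1 ∩ t'.1, i ≠ j →
    ∀ x ∈ openSegment ℝ (vertex t i) (vertex t j),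
    ∀ y ∈ openSegment ℝ (vertex t i) (vertex t j),
      signedKleinDist (circle t') (vertex t' i) (glue t t' i j x) (glue t t' i j y) =
        signedKleinDist (circle t) (vertex t i) x y

namespace IdealTriangulation

variable {V : Type*} [DecidableEq V] {T : SurfaceTriangulation V}

/-- The side `ij` of the ideal triangle `t`. -/
def side (X : IdealTriangulation T) (t : T.Face) (i j : V) : Set Plane :=
  openSegment ℝ (X.vertex t i) (X.vertex t j)

/-- `Z` is the shear coordinate on the interior edge `ij` between the triangles `ijk` and `ilj`:
the signed distance along the edge, in the direction from `i` to `j`, from the base point of the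
height from `k` to the base point of the height from `l` (the latter is carried to the side `ij`
of the triangle `ijk` by the gluing map).  Interchanging `(i, k)` with `(j, l)` changes nothing;
the labeling `(j, i, k, l)` belongs to the opposite local orientation. -/
def IsShear (X : IdealTriangulation T) (i j k l : V) (hk : {i, j, k} ∈ T.triangles)
    (hl : {i, l, j} ∈ T.triangles) (Z : ℝ) : Prop :=
  ∃ a b : Plane,
    IsHeightFoot (X.circle ⟨_, hk⟩) (X.vertex ⟨_, hk⟩ k) (X.vertex ⟨_, hk⟩ i)
      (X.vertex ⟨_, hk⟩ j) a ∧
    IsHeightFoot (X.circle ⟨_, hl⟩) (X.vertex ⟨_, hl⟩ l) (X.vertex ⟨_, hl⟩ i)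
      (X.vertex ⟨_, hl⟩ j) b ∧
    Z = signedKleinDist (X.circle ⟨_, hk⟩) (X.vertex ⟨_, hk⟩ i) a
      (X.glue ⟨_, hl⟩ ⟨_, hk⟩ i j b)

/-- A choice of horocycles: in each triangle one horocycle centered at each vertex, such that the
horocycles in triangles with a common edge fit together along this edge. -/
structure Decoration (X : IdealTriangulation T) where
  horo : T.Face → V → Set Plane
  isHorocycle : ∀ t : T.Face, ∀ i ∈ t.1, IsHorocycle (X.circle t) (X.vertex t i) (horo t i)
  fits : ∀ t t' : T.Face, t ≠ t' → ∀ i ∈ t.1 ∩ t'.1, ∀ j ∈ t.1 ∩ t'.1, i ≠ j →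
    X.glue t t' i j '' (horo t i ∩ X.side t i j) = horo t' i ∩ X.side t' i j

/-- `μ` is the signed distance between the horocycles at `i` and `j`, measured along the edge `ij`
in the triangle `t`: positive if the horocycle at `i` meets the edge before the horocycle at `j`
does (in the direction from `i` to `j`), negative if it is the other way around. -/
def Decoration.IsPenner {X : IdealTriangulation T} (D : X.Decoration) (t : T.Face) (i j : V)
    (μ : ℝ) : Prop :=
  ∃ x ∈ D.horo t i ∩ X.side t i j, ∃ y ∈ D.horo t j ∩ X.side t i j,
    μ = signedKleinDist (X.circle t) (X.vertex t i) x y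

end IdealTriangulation

/-! ### The ideal triangulation induced by a euclidean triangulation -/

/-- The triangles of the euclidean triangulation `(T, ℓ)`, each laid out in the euclidean plane
together with its circumcircle. -/
structure DiscreteMetric.Layout {V : Type*} [DecidableEq V] {T : SurfaceTriangulation V}
    (ℓ : DiscreteMetric T) where
  pos : T.Face → V → Plane
  circumcircle : T.Face → Circ
  dist_eq : ∀ t : T.Face, ∀ i ∈ t.1, ∀ j ∈ t.1, i ≠ j → dist (pos t i) (pos t j) = ℓ.len s(i, j)
  mem_circle : ∀ t : T.Face, ∀ i ∈ t.1, pos t i ∈ circumcircle t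

theorem kleinDist_lineMap (S : Circ) {p q : Plane} (hp : p ∈ S) (hq : q ∈ S) (hpq : p ≠ q)
    {s r : ℝ} (hs : s ∈ Set.Ioo (0 : ℝ) 1) (hr : r ∈ Set.Ioo (0 : ℝ) 1) :
    kleinDist S (AffineMap.lineMap p q s) (AffineMap.lineMap p q r) =
      Real.arcosh (((1 - s) * r + s * (1 - r)) /
        (2 * (Real.sqrt (s * (1 - s)) * Real.sqrt (r * (1 - r))))) := by
  obtain ⟨c, R⟩ := S
  have hu : inner ℝ (p - c) (p - c) = R ^ 2 := by
    rw [real_inner_self_eq_norm_sq, ← dist_eq_norm, EuclideanGeometry.mem_sphere.1 hp]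
  have hv : inner ℝ (q - c) (q - c) = R ^ 2 := by
    rw [real_inner_self_eq_norm_sq, ← dist_eq_norm, EuclideanGeometry.mem_sphere.1 hq]
  have hL : 0 < ‖p - q‖ := norm_pos_iff.2 (sub_ne_zero.2 hpq)
  have hw : ‖p - q‖ ^ 2 = 2 * R ^ 2 - 2 * inner ℝ (p - c) (q - c) := by
    have h : p - q = (p - c) - (q - c) := by abel
    rw [h, norm_sub_sq_real, ← real_inner_self_eq_norm_sq, ← real_inner_self_eq_norm_sq, hu, hv]
    ring
  have key : ∀ a b : ℝ, R ^ 2 - inner ℝ (AffineMap.lineMap p q a - c)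
      (AffineMap.lineMap p q b - c) = ‖p - q‖ ^ 2 / 2 * ((1 - a) * b + a * (1 - b)) := by
    intro a b
    have h : ∀ a : ℝ, AffineMap.lineMap p q a - c = (1 - a) • (p - c) + a • (q - c) := by
      intro a
      rw [AffineMap.lineMap_apply_module]
      module
    rw [h, h]
    simp only [inner_add_left, inner_add_right, real_inner_smul_left, real_inner_smul_right, hu, hv,
      real_inner_comm (p - c) (q - c)]
    rw [hw]
    ring
  have key2 : ∀ a : ℝ, Real.sqrt (R ^ 2 - ‖AffineMap.lineMap p q a - c‖ ^ 2) =
      ‖p - q‖ * Real.sqrt (a * (1 - a)) := by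
    intro a
    rw [← real_inner_self_eq_norm_sq, key a a,
      show ‖p - q‖ ^ 2 / 2 * ((1 - a) * a + a * (1 - a)) = ‖p - q‖ ^ 2 * (a * (1 - a)) by ring,
      Real.sqrt_mul (sq_nonneg _), Real.sqrt_sq hL.le]
  have h1 : 0 < Real.sqrt (s * (1 - s)) := Real.sqrt_pos.2 (mul_pos hs.1 (by linarith [hs.2]))
  have h2 : 0 < Real.sqrt (r * (1 - r)) := Real.sqrt_pos.2 (mul_pos hr.1 (by linarith [hr.2]))
  unfold kleinDist
  simp only
  rw [key, key2, key2]
  congr 1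
  field_simp

theorem signedKleinDist_lineMap (S : Circ) {p q : Plane} (hp : p ∈ S) (hq : q ∈ S) (hpq : p ≠ q)
    {s r : ℝ} (hs : s ∈ Set.Ioo (0 : ℝ) 1) (hr : r ∈ Set.Ioo (0 : ℝ) 1) :
    signedKleinDist S p (AffineMap.lineMap p q s) (AffineMap.lineMap p q r) =
      (if s ≤ r then 1 else -1) * Real.arcosh (((1 - s) * r + s * (1 - r)) /
        (2 * (Real.sqrt (s * (1 - s)) * Real.sqrt (r * (1 - r))))) := by
  have h : ∀ a ∈ Set.Ioo (0 : ℝ) 1, dist p (AffineMap.lineMap p q a) = a * dist p q := by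
    intro a ha
    rw [dist_left_lineMap, Real.norm_of_nonneg ha.1.le]
  have hd : 0 < dist p q := dist_pos.2 hpq
  unfold signedKleinDist
  rw [h s hs, h r hr, kleinDist_lineMap S hp hq hpq hs hr]
  simp only [mul_le_mul_iff_left₀ hd]
  split_ifs <;> simp

/-- The isometry from the euclidean segment `pq` to the segment `p'q'` (of the same length). -/
def edgeMap (p q p' q' x : Plane) : Plane :=
  AffineMap.lineMap p' q' (dist p x / dist p q)

theorem edgeMap_lineMap {p q : Plane} (hpq : p ≠ q) (p' q' : Plane) {s : ℝ} (hs : 0 ≤ s) :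
    edgeMap p q p' q' (AffineMap.lineMap p q s) = AffineMap.lineMap p' q' s := by
  have hd : dist p q ≠ 0 := dist_ne_zero.2 hpq
  rw [edgeMap, dist_left_lineMap, Real.norm_of_nonneg hs, mul_div_assoc, div_self hd, mul_one]

theorem mem_openSegment_iff_lineMap {p q x : Plane} :
    x ∈ openSegment ℝ p q ↔ ∃ s ∈ Set.Ioo (0 : ℝ) 1, AffineMap.lineMap p q s = x := by
  rw [openSegment_eq_image_lineMap]
  rfl

namespace DiscreteMetric.Layout

variable {V : Type*} [DecidableEq V] {T : SurfaceTriangulation V} {ℓ : DiscreteMetric T}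

theorem pos_ne (P : ℓ.Layout) (t : T.Face) {i j : V} (hi : i ∈ t.1) (hj : j ∈ t.1) (hij : i ≠ j) :
    P.pos t i ≠ P.pos t j := by
  rw [← dist_pos, P.dist_eq t i hi j hj hij]
  exact ℓ.len_pos t.1 t.2 i hi j hj hij

/-- The ideal triangulation induced by the euclidean triangulation `(T, ℓ)`: the interior of the
circumcircle of each triangle is regarded as a hyperbolic plane in the Klein model, and the
triangles are glued along their edges just as the euclidean triangles are. -/
def idealTriangulation (P : ℓ.Layout) : IdealTriangulation T where
  circle := P.circumcircle
  vertex := P.pos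
  glue t t' i j := edgeMap (P.pos t i) (P.pos t j) (P.pos t' i) (P.pos t' j)
  vertex_mem := P.mem_circle
  vertex_injOn t i hi j hj h := by
    by_contra hij
    exact P.pos_ne t hi hj hij h
  glue_mapsTo t t' _ i hi j hj hij x hx := by
    obtain ⟨s, hs, rfl⟩ := mem_openSegment_iff_lineMap.1 hx
    rw [Finset.mem_inter] at hi hj
    rw [edgeMap_lineMap (P.pos_ne t hi.1 hj.1 hij) _ _ hs.1.le]
    exact mem_openSegment_iff_lineMap.2 ⟨s, hs, rfl⟩
  glue_inv t t' _ i hi j hj hij x hx := by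
    obtain ⟨s, hs, rfl⟩ := mem_openSegment_iff_lineMap.1 hx
    rw [Finset.mem_inter] at hi hj
    rw [edgeMap_lineMap (P.pos_ne t hi.1 hj.1 hij) _ _ hs.1.le,
      edgeMap_lineMap (P.pos_ne t' hi.2 hj.2 hij) _ _ hs.1.le]
  glue_swap t t' _ i hi j hj hij x hx := by
    obtain ⟨s, hs, rfl⟩ := mem_openSegment_iff_lineMap.1 hx
    rw [Finset.mem_inter] at hi hj
    have hs' : 0 ≤ 1 - s := by linarith [hs.2]
    rw [edgeMap_lineMap (P.pos_ne t hi.1 hj.1 hij) _ _ hs.1.le,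
      ← AffineMap.lineMap_apply_one_sub (P.pos t j) (P.pos t i) s,
      edgeMap_lineMap (P.pos_ne t hj.1 hi.1 hij.symm) _ _ hs', AffineMap.lineMap_apply_one_sub]
  glue_signedKleinDist t t' _ i hi j hj hij x hx y hy := by
    obtain ⟨s, hs, rfl⟩ := mem_openSegment_iff_lineMap.1 hx
    obtain ⟨r, hr, rfl⟩ := mem_openSegment_iff_lineMap.1 hy
    rw [Finset.mem_inter] at hi hj
    rw [edgeMap_lineMap (P.pos_ne t hi.1 hj.1 hij) _ _ hs.1.le,
      edgeMap_lineMap (P.pos_ne t hi.1 hj.1 hij) _ _ hr.1.le,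
      signedKleinDist_lineMap _ (P.mem_circle t i hi.1) (P.mem_circle t j hj.1)
        (P.pos_ne t hi.1 hj.1 hij) hs hr,
      signedKleinDist_lineMap _ (P.mem_circle t' i hi.2) (P.mem_circle t' j hj.2)
        (P.pos_ne t' hi.2 hj.2 hij) hs hr]

end DiscreteMetric.Layout

theorem exists_triangle_in_circle {a b c : ℝ} (hc : 0 < c) (ha : 0 < a) (hb : 0 < b)
    (h1 : a < b + c) (h2 : b < c + a) (h3 : c < a + b) :
    ∃ (p q r : Plane) (S : Circ), p ∈ S ∧ q ∈ S ∧ r ∈ S ∧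
      dist p q = c ∧ dist q r = a ∧ dist p r = b := by
  set x : ℝ := (c ^ 2 + b ^ 2 - a ^ 2) / (2 * c) with hx
  have hxc : 2 * c * x = c ^ 2 + b ^ 2 - a ^ 2 := by rw [hx]; field_simp
  have hy2 : 0 < b ^ 2 - x ^ 2 := by
    have h : 4 * c ^ 2 * (b ^ 2 - x ^ 2) =
        ((a + b + c) * (b + c - a)) * ((c + a - b) * (a + b - c)) := by
      have : 4 * c ^ 2 * (b ^ 2 - x ^ 2) = 4 * c ^ 2 * b ^ 2 - (2 * c * x) ^ 2 := by ring
      rw [this, hxc]; ring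
    have h' : 0 < ((a + b + c) * (b + c - a)) * ((c + a - b) * (a + b - c)) :=
      mul_pos (mul_pos (by linarith) (by linarith)) (mul_pos (by linarith) (by linarith))
    rw [← h] at h'
    exact pos_of_mul_pos_right h' (by positivity)
  set y : ℝ := Real.sqrt (b ^ 2 - x ^ 2) with hy
  have hypos : 0 < y := Real.sqrt_pos.2 hy2
  have hysq : y ^ 2 = b ^ 2 - x ^ 2 := Real.sq_sqrt hy2.le
  set u : ℝ := (b ^ 2 - c * x) / (2 * y) with hu
  have huy : 2 * y * u = b ^ 2 - c * x := by rw [hu]; field_simp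
  refine ⟨!₂[0, 0], !₂[c, 0], !₂[x, y],
    ⟨!₂[c / 2, u], Real.sqrt ((c / 2) ^ 2 + u ^ 2)⟩, ?_, ?_, ?_, ?_, ?_, ?_⟩
  · rw [EuclideanGeometry.mem_sphere, EuclideanSpace.dist_eq]
    simp [Fin.sum_univ_two, Real.dist_eq, sq_abs]
  · rw [EuclideanGeometry.mem_sphere, EuclideanSpace.dist_eq]
    simp only [Fin.sum_univ_two, Real.dist_eq, sq_abs]
    congr 1
    simp
    ring
  · rw [EuclideanGeometry.mem_sphere, EuclideanSpace.dist_eq]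
    simp only [Fin.sum_univ_two, Real.dist_eq, sq_abs]
    congr 1
    simp
    nlinarith
  · rw [EuclideanSpace.dist_eq]
    simp [Fin.sum_univ_two, Real.dist_eq, sq_abs, Real.sqrt_sq hc.le]
  · rw [EuclideanSpace.dist_eq, Real.sqrt_eq_iff_mul_self_eq (by positivity) ha.le]
    simp only [Fin.sum_univ_two, Real.dist_eq, sq_abs]
    simp
    nlinarith
  · rw [EuclideanSpace.dist_eq, Real.sqrt_eq_iff_mul_self_eq (by positivity) hb.le]
    simp only [Fin.sum_univ_two, Real.dist_eq, sq_abs]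
    simp
    nlinarith

/-- Every euclidean triangulation can be laid out. -/
theorem DiscreteMetric.nonempty_layout {V : Type*} [DecidableEq V] {T : SurfaceTriangulation V}
    (ℓ : DiscreteMetric T) : Nonempty ℓ.Layout := by
  have h : ∀ t : T.Face, ∃ (f : V → Plane) (S : Circ),
      (∀ i ∈ t.1, ∀ j ∈ t.1, i ≠ j → dist (f i) (f j) = ℓ.len s(i, j)) ∧ ∀ i ∈ t.1, f i ∈ S := by
    rintro ⟨t, ht⟩
    obtain ⟨i, j, k, hij, hik, hjk, rfl⟩ := Finset.card_eq_three.1 (T.card_eq t ht)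
    have e1 : ({j, k, i} : Finset V) = {i, j, k} := by ext; simp; tauto
    have e2 : ({k, i, j} : Finset V) = {i, j, k} := by ext; simp; tauto
    have e3 : ({i, k, j} : Finset V) = {i, j, k} := by ext; simp; tauto
    have l1 := ℓ.triangle_ineq i j k ht
    have l2 := ℓ.triangle_ineq j k i (e1 ▸ ht)
    have l3 := ℓ.triangle_ineq i k j (e3 ▸ ht)
    rw [Sym2.eq_swap (a := k) (b := j)] at l1
    rw [Sym2.eq_swap (a := j) (b := i)] at l2
    obtain ⟨p, q, r, S, hp, hq, hr, h1, h2, h3⟩ := exists_triangle_in_circle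
      (ℓ.len_pos _ ht i (by simp) j (by simp) hij) (ℓ.len_pos _ ht j (by simp) k (by simp) hjk)
      (ℓ.len_pos _ ht i (by simp) k (by simp) hik) (by linarith) (by linarith) (by linarith)
    refine ⟨fun v => if v = i then p else if v = j then q else r, S, ?_, ?_⟩
    · intro a ha b hb hab
      simp only [Finset.mem_insert, Finset.mem_singleton] at ha hb
      rcases ha with rfl | rfl | rfl <;> rcases hb with rfl | rfl | rfl <;>
        simp_all [Ne.symm, dist_comm, Sym2.eq_swap, eq_comm]
    · intro a _
      dsimp only
      split_ifs <;> assumption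
  choose f S hf hS using h
  exact ⟨⟨f, S, hf, hS⟩⟩

end

/-!
The side `pq` of an ideal triangle inscribed in a circle `S` is the euclidean open segment `pq`, so
its points are `AffineMap.lineMap p q s` with `s ∈ (0, 1)`.  The function `½ log (s / (1 - s))` is an
arc length parameter of this hyperbolic line (`signedKleinDist_lineMap_eq_log`), and since the
triangles are glued by euclidean isometries of their sides, gluing preserves `s`.  Everything
reduces to finding the parameters of the feet of the heights and of the points where the horocycles
meet the sides.

*Shear coordinates.*  The height from `v` meets `pq` in the point that divides `pq` in the ratio
`|pv|² : |qv|²`, the foot of the euclidean symmedian (`isHeightFoot_iff`).  The difference of the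
arc length parameters of the two feet is the logarithm of the length-cross-ratio.

*Penner coordinates.*  The horocycles at an ideal point `v` are the level sets of
`x ↦ (R² - ⟪x - c, v - c⟫) / √(R² - ‖x - c‖²)`, the exponential of the Busemann function
(`tendsto_kleinDist_sub_kleinDist`).  At the point of parameter `s` of the side `pq`, this function
with `v = p` takes the value `½ |pq| √(s / (1 - s))`, which depends on the edge length but not on
the circumcircle.  Hence the level sets for any fixed level fit together along the edges.  The
level `1/2` is the one for which `s / (1 - s) = |pq|⁻²`; the horocycle at `q` then meets the side in
the point with `s / (1 - s) = |pq|²`, and the signed distance is `2 log |pq|`.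
-/

open Filter Topology

/-! ### The arc length parameter of a hyperbolic line -/

theorem Real.arcosh_cosh_eq_abs (x : ℝ) : Real.arcosh (Real.cosh x) = |x| := by
  rw [← Real.cosh_abs, Real.arcosh_cosh (abs_nonneg x)]

theorem Real.cosh_half_log_sub_log {u w : ℝ} (hu : 0 < u) (hw : 0 < w) :
    Real.cosh ((Real.log u - Real.log w) / 2) = (u + w) / (2 * (√u * √w)) := by
  have hu' : 0 < √u := Real.sqrt_pos.2 hu
  have hw' : 0 < √w := Real.sqrt_pos.2 hw
  have h : (Real.log u - Real.log w) / 2 = Real.log (√u / √w) := by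
    rw [Real.log_div hu'.ne' hw'.ne', Real.log_sqrt hu.le, Real.log_sqrt hw.le]
    ring
  rw [h, Real.cosh_log (div_pos hu' hw')]
  have e : u + w = √u ^ 2 + √w ^ 2 := by rw [Real.sq_sqrt hu.le, Real.sq_sqrt hw.le]
  rw [e]
  field_simp

/-- `½ log (s / (1 - s))` is an arc length parameter of the hyperbolic line `pq`. -/
theorem signedKleinDist_lineMap_eq_log (S : Circ) {p q : Plane} (hp : p ∈ S) (hq : q ∈ S)
    (hpq : p ≠ q) {s r : ℝ} (hs : s ∈ Set.Ioo (0 : ℝ) 1) (hr : r ∈ Set.Ioo (0 : ℝ) 1) :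
    signedKleinDist S p (AffineMap.lineMap p q s) (AffineMap.lineMap p q r) =
      (Real.log (r / (1 - r)) - Real.log (s / (1 - s))) / 2 := by
  obtain ⟨hs0, hs1⟩ := hs
  obtain ⟨hr0, hr1⟩ := hr
  have hs1' : 0 < 1 - s := sub_pos.2 hs1
  have hr1' : 0 < 1 - r := sub_pos.2 hr1
  have hu : 0 < (1 - s) * r := mul_pos hs1' hr0
  have hw : 0 < s * (1 - r) := mul_pos hs0 hr1'
  have hsqrt : √(s * (1 - s)) * √(r * (1 - r)) = √((1 - s) * r) * √(s * (1 - r)) := by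
    rw [← Real.sqrt_mul (by positivity), ← Real.sqrt_mul (by positivity)]
    congr 1
    ring
  have hlog : Real.log (r / (1 - r)) - Real.log (s / (1 - s)) =
      Real.log ((1 - s) * r) - Real.log (s * (1 - r)) := by
    rw [Real.log_div hr0.ne' hr1'.ne', Real.log_div hs0.ne' hs1'.ne',
      Real.log_mul hs1'.ne' hr0.ne', Real.log_mul hs0.ne' hr1'.ne']
    ring
  rw [signedKleinDist_lineMap S hp hq hpq ⟨hs0, hs1⟩ ⟨hr0, hr1⟩, hsqrt,
    ← Real.cosh_half_log_sub_log hu hw, Real.arcosh_cosh_eq_abs, hlog]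
  split_ifs with h
  · have : s * (1 - r) ≤ (1 - s) * r := by nlinarith
    have := Real.log_le_log hw this
    rw [abs_of_nonneg (by linarith), one_mul]
  · have : (1 - s) * r ≤ s * (1 - r) := by nlinarith
    have := Real.log_le_log hu this
    rw [abs_of_nonpos (by linarith)]
    ring

/-! ### Chords of a circle -/

theorem radius_sq_sub_inner_eq (S : Circ) {p q : Plane} (hp : p ∈ S) (hq : q ∈ S) :
    S.radius ^ 2 - inner ℝ (p - S.center) (q - S.center) = dist p q ^ 2 / 2 := by
  have h := norm_sub_sq_real (p - S.center) (q - S.center)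
  rw [sub_sub_sub_cancel_right, ← dist_eq_norm, ← dist_eq_norm, ← dist_eq_norm,
    EuclideanGeometry.mem_sphere.1 hp, EuclideanGeometry.mem_sphere.1 hq] at h
  linarith

/-- Polarization of the power of a point with respect to the circle, along a chord. -/
theorem radius_sq_sub_inner_lineMap (S : Circ) {p q : Plane} (hp : p ∈ S) (hq : q ∈ S) (a b : ℝ) :
    S.radius ^ 2 - inner ℝ (AffineMap.lineMap p q a - S.center)
      (AffineMap.lineMap p q b - S.center) =
        dist p q ^ 2 / 2 * ((1 - a) * b + a * (1 - b)) := by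
  have h : ∀ a : ℝ, AffineMap.lineMap p q a - S.center =
      (1 - a) • (p - S.center) + a • (q - S.center) := by
    intro a
    rw [AffineMap.lineMap_apply_module]
    module
  have hu := radius_sq_sub_inner_eq S hp hp
  have hv := radius_sq_sub_inner_eq S hq hq
  have hw := radius_sq_sub_inner_eq S hp hq
  rw [dist_self] at hu hv
  rw [h, h]
  simp only [inner_add_left, inner_add_right, real_inner_smul_left, real_inner_smul_right,
    real_inner_comm (p - S.center) (q - S.center)]
  linear_combination (1 - a) * (1 - b) * hu + a * b * hv + ((1 - a) * b + a * (1 - b)) * hw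

theorem radius_sq_sub_norm_sq_lineMap (S : Circ) {p q : Plane} (hp : p ∈ S) (hq : q ∈ S) (a : ℝ) :
    S.radius ^ 2 - ‖AffineMap.lineMap p q a - S.center‖ ^ 2 = dist p q ^ 2 * (a * (1 - a)) := by
  rw [← real_inner_self_eq_norm_sq, radius_sq_sub_inner_lineMap S hp hq]
  ring

theorem lineMap_mem_kleinDisk (S : Circ) {p q : Plane} (hp : p ∈ S) (hq : q ∈ S) (hpq : p ≠ q)
    {s : ℝ} (hs : s ∈ Set.Ioo (0 : ℝ) 1) : AffineMap.lineMap p q s ∈ kleinDisk S :=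
  openSegment_subset_ball_of_ne (Metric.mem_closedBall.2 (EuclideanGeometry.mem_sphere.1 hp).le)
    (Metric.mem_closedBall.2 (EuclideanGeometry.mem_sphere.1 hq).le) hpq
    (mem_openSegment_iff_lineMap.2 ⟨s, hs, rfl⟩)

/-! ### Heights of ideal triangles -/

theorem kleinMetric_height (S : Circ) {p q v : Plane} (hp : p ∈ S) (hq : q ∈ S) (hv : v ∈ S)
    (hpq : p ≠ q) {s : ℝ} (hs : s ∈ Set.Ioo (0 : ℝ) 1) :
    kleinMetric S (AffineMap.lineMap p q s) (v - AffineMap.lineMap p q s) (q - p) =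
      ((1 - s) * dist p v ^ 2 - s * dist q v ^ 2) /
        (4 * dist p q ^ 2 * (s * (1 - s)) ^ 2) := by
  have hs1' : 0 < 1 - s := sub_pos.2 hs.2
  have hs0 : 0 < s := hs.1
  have hL : 0 < dist p q := dist_pos.2 hpq
  have e : AffineMap.lineMap p q s - S.center = (1 - s) • (p - S.center) + s • (q - S.center) := by
    rw [AffineMap.lineMap_apply_module]
    module
  have e1 : v - AffineMap.lineMap p q s =
      (v - S.center) - ((1 - s) • (p - S.center) + s • (q - S.center)) := by
    rw [← e]
    abel
  have e2 : q - p = (q - S.center) - (p - S.center) := by abel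
  have hpp := radius_sq_sub_inner_eq S hp hp
  have hqq := radius_sq_sub_inner_eq S hq hq
  have hpq' := radius_sq_sub_inner_eq S hp hq
  have hpv := radius_sq_sub_inner_eq S hp hv
  have hqv := radius_sq_sub_inner_eq S hq hv
  rw [dist_self] at hpp hqq
  unfold kleinMetric
  rw [radius_sq_sub_norm_sq_lineMap S hp hq, e, e1, e2]
  generalize p - S.center = a at *
  generalize q - S.center = b at *
  generalize v - S.center = c at *
  have haa : inner ℝ a a = S.radius ^ 2 := by linarith
  have hbb : inner ℝ b b = S.radius ^ 2 := by linarith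
  have hab : inner ℝ a b = S.radius ^ 2 - dist p q ^ 2 / 2 := by linarith
  have hac : inner ℝ a c = S.radius ^ 2 - dist p v ^ 2 / 2 := by linarith
  have hbc : inner ℝ b c = S.radius ^ 2 - dist q v ^ 2 / 2 := by linarith
  simp only [inner_add_left, inner_add_right, inner_sub_left, inner_sub_right,
    real_inner_smul_left, real_inner_smul_right, real_inner_comm a b, real_inner_comm a c,
    real_inner_comm b c, haa, hbb, hab, hac, hbc]
  field_simp
  ring

/-- The hyperbolic height from `v` is the euclidean symmedian: its foot divides `pq` in the ratio
`|pv|² : |qv|²`. -/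
theorem isHeightFoot_iff (S : Circ) {p q v a : Plane} (hp : p ∈ S) (hq : q ∈ S) (hv : v ∈ S)
    (hpq : p ≠ q) (hpv : p ≠ v) (hqv : q ≠ v) :
    IsHeightFoot S v p q a ↔
      a = AffineMap.lineMap p q (dist p v ^ 2 / (dist p v ^ 2 + dist q v ^ 2)) := by
  have hL : 0 < dist p q := dist_pos.2 hpq
  have hA : 0 < dist p v := dist_pos.2 hpv
  have hB : 0 < dist q v := dist_pos.2 hqv
  have key : ∀ s ∈ Set.Ioo (0 : ℝ) 1,
      kleinMetric S (AffineMap.lineMap p q s) (v - AffineMap.lineMap p q s) (q - p) = 0 ↔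
        s = dist p v ^ 2 / (dist p v ^ 2 + dist q v ^ 2) := by
    intro s hs
    have hs1' : 0 < 1 - s := sub_pos.2 hs.2
    have hs0 : 0 < s := hs.1
    rw [kleinMetric_height S hp hq hv hpq hs, div_eq_zero_iff, or_iff_left (by positivity),
      eq_div_iff (by positivity)]
    constructor <;> intro h <;> linarith
  constructor
  · rintro ⟨ha, h⟩
    obtain ⟨s, hs, rfl⟩ := mem_openSegment_iff_lineMap.1 ha
    rw [(key s hs).1 h]
  · rintro rfl
    have hs : dist p v ^ 2 / (dist p v ^ 2 + dist q v ^ 2) ∈ Set.Ioo (0 : ℝ) 1 :=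
      ⟨by positivity, (div_lt_one (by positivity)).2 (lt_add_of_pos_right _ (by positivity))⟩
    exact ⟨mem_openSegment_iff_lineMap.2 ⟨_, hs, rfl⟩, (key _ hs).2 rfl⟩

/-! ### Horocycles -/

theorem Real.tendsto_arcosh_sub_log_atTop :
    Tendsto (fun t => Real.arcosh t - Real.log t) atTop (𝓝 (Real.log 2)) := by
  have h1 : Tendsto (fun t : ℝ => Real.log (1 + √(1 - (t ^ 2)⁻¹))) atTop (𝓝 (Real.log 2)) := by
    have h0 : Tendsto (fun t : ℝ => (t ^ 2)⁻¹) atTop (𝓝 0) :=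
      tendsto_inv_atTop_zero.comp (tendsto_pow_atTop two_ne_zero)
    have h := ((h0.const_sub 1).sqrt).const_add 1
    rw [sub_zero, Real.sqrt_one, one_add_one_eq_two] at h
    exact h.log two_ne_zero
  refine h1.congr' ?_
  filter_upwards [eventually_ge_atTop 1] with t ht
  have ht0 : 0 < t := by linarith
  have e : √(t ^ 2 - 1) = t * √(1 - (t ^ 2)⁻¹) := by
    rw [show t ^ 2 - 1 = t ^ 2 * (1 - (t ^ 2)⁻¹) by field_simp, Real.sqrt_mul (sq_nonneg t),
      Real.sqrt_sq ht0.le]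
  rw [Real.arcosh, e, ← Real.log_div (by positivity) ht0.ne']
  congr 1
  field_simp

/-- The exponential of the Busemann function at the ideal point `v`, up to a constant factor. -/
noncomputable def expBusemann (S : Circ) (v x : Plane) : ℝ :=
  (S.radius ^ 2 - inner ℝ (x - S.center) (v - S.center)) / √(S.radius ^ 2 - ‖x - S.center‖ ^ 2)

theorem sqrt_radius_sq_sub_norm_sq_pos {S : Circ} {x : Plane} (hx : x ∈ kleinDisk S) :
    0 < √(S.radius ^ 2 - ‖x - S.center‖ ^ 2) := by
  have h : ‖x - S.center‖ < S.radius := by rw [← dist_eq_norm]; exact hx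
  exact Real.sqrt_pos.2 (sub_pos.2 (pow_lt_pow_left₀ h (norm_nonneg _) two_ne_zero))

theorem radius_sq_sub_inner_pos {S : Circ} {v x : Plane} (hv : v ∈ S) (hx : x ∈ kleinDisk S) :
    0 < S.radius ^ 2 - inner ℝ (x - S.center) (v - S.center) := by
  have h : ‖x - S.center‖ < S.radius := by rw [← dist_eq_norm]; exact hx
  have h' : ‖v - S.center‖ = S.radius := by rw [← dist_eq_norm]; exact hv
  have hR : 0 < S.radius := (norm_nonneg _).trans_lt h
  have := real_inner_le_norm (x - S.center) (v - S.center)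
  rw [h'] at this
  nlinarith

theorem expBusemann_pos {S : Circ} {v x : Plane} (hv : v ∈ S) (hx : x ∈ kleinDisk S) :
    0 < expBusemann S v x :=
  div_pos (radius_sq_sub_inner_pos hv hx) (sqrt_radius_sq_sub_norm_sq_pos hx)

theorem tendsto_expBusemann {S : Circ} {v : Plane} (x : Plane) :
    Tendsto (fun y => expBusemann S y x) (𝓝[kleinDisk S] v) (𝓝 (expBusemann S v x)) := by
  have h : Continuous fun y => expBusemann S y x := by
    unfold expBusemann
    fun_prop
  exact h.continuousWithinAt

theorem kleinDist_eq_arcosh_expBusemann (S : Circ) (x y : Plane) :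
    kleinDist S x y =
      Real.arcosh (expBusemann S y x * (√(S.radius ^ 2 - ‖y - S.center‖ ^ 2))⁻¹) := by
  rw [kleinDist, expBusemann, ← div_eq_mul_inv, div_div]

/-- The Busemann function at `v` is the limit of differences of distances.  Since
`arcosh t - log t` converges at infinity, the distances may be replaced by logarithms, and then the
factor depending only on `y` cancels. -/
theorem tendsto_kleinDist_sub_kleinDist {S : Circ} {v x x₀ : Plane} (hv : v ∈ S)
    (hx : x ∈ kleinDisk S) (hx₀ : x₀ ∈ kleinDisk S) :
    Tendsto (fun y => kleinDist S x y - kleinDist S x₀ y) (𝓝[kleinDisk S] v)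
      (𝓝 (Real.log (expBusemann S v x) - Real.log (expBusemann S v x₀))) := by
  have hD : Tendsto (fun y => (√(S.radius ^ 2 - ‖y - S.center‖ ^ 2))⁻¹) (𝓝[kleinDisk S] v)
      atTop := by
    refine tendsto_inv_nhdsGT_zero.comp (tendsto_nhdsWithin_iff.2 ⟨?_, ?_⟩)
    · have hc : Continuous fun y : Plane => √(S.radius ^ 2 - ‖y - S.center‖ ^ 2) := by fun_prop
      have h := (hc.continuousWithinAt (s := kleinDisk S) (x := v)).tendsto
      have h' : ‖v - S.center‖ = S.radius := by rw [← dist_eq_norm]; exact hv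
      simpa only [h', sub_self, Real.sqrt_zero] using h
    · filter_upwards [self_mem_nhdsWithin] with y hy
      exact sqrt_radius_sq_sub_norm_sq_pos hy
  have hA : ∀ z ∈ kleinDisk S, Tendsto (fun y => kleinDist S z y -
      Real.log (expBusemann S y z * (√(S.radius ^ 2 - ‖y - S.center‖ ^ 2))⁻¹)) (𝓝[kleinDisk S] v)
      (𝓝 (Real.log 2)) := by
    intro z hz
    simp only [kleinDist_eq_arcosh_expBusemann]
    exact Real.tendsto_arcosh_sub_log_atTop.comp
      ((tendsto_expBusemann z).pos_mul_atTop (expBusemann_pos hv hz) hD)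
  have hB : ∀ z ∈ kleinDisk S, Tendsto (fun y => Real.log (expBusemann S y z)) (𝓝[kleinDisk S] v)
      (𝓝 (Real.log (expBusemann S v z))) := fun z hz =>
    (tendsto_expBusemann z).log (expBusemann_pos hv hz).ne'
  have hpos : ∀ z ∈ kleinDisk S, ∀ᶠ y in 𝓝[kleinDisk S] v, 0 < expBusemann S y z := fun z hz =>
    (tendsto_expBusemann z).eventually_const_lt (expBusemann_pos hv hz)
  have h := ((hA x hx).sub (hA x₀ hx₀)).add ((hB x hx).sub (hB x₀ hx₀))
  rw [sub_self, zero_add] at h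
  refine h.congr' ?_
  filter_upwards [hpos x hx, hpos x₀ hx₀, self_mem_nhdsWithin] with y h1 h2 hy
  have h3 := inv_pos.2 (sqrt_radius_sq_sub_norm_sq_pos hy)
  rw [Real.log_mul h1.ne' h3.ne', Real.log_mul h2.ne' h3.ne']
  ring

theorem horocycle_eq {S : Circ} {v x₀ : Plane} (hv : v ∈ S) (hx₀ : x₀ ∈ kleinDisk S) :
    horocycle S v x₀ = {x ∈ kleinDisk S | expBusemann S v x = expBusemann S v x₀} := by
  have hR : 0 < S.radius := dist_nonneg.trans_lt hx₀
  -- uniqueness of limits needs that the ideal point is a limit of points of the disk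
  have : (𝓝[kleinDisk S] v).NeBot := by
    rw [← mem_closure_iff_nhdsWithin_neBot, kleinDisk, closure_ball _ hR.ne']
    exact Metric.mem_closedBall.2 (EuclideanGeometry.mem_sphere.1 hv).le
  ext x
  refine and_congr_right fun hx => ?_
  have h := tendsto_kleinDist_sub_kleinDist hv hx hx₀
  constructor
  · intro h0
    exact Real.log_injOn_pos (expBusemann_pos hv hx) (expBusemann_pos hv hx₀)
      (sub_eq_zero.1 (tendsto_nhds_unique h h0))
  · intro h0
    rwa [h0, sub_self] at h

/-- The horocycle at the ideal point `v` on which `expBusemann` equals `1/2`. -/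
noncomputable def halfHorocycle (S : Circ) (v : Plane) : Set Plane :=
  {x ∈ kleinDisk S | expBusemann S v x = 1 / 2}

theorem lineMap_mem_halfHorocycle_iff (S : Circ) {p q : Plane} (hp : p ∈ S) (hq : q ∈ S)
    (hpq : p ≠ q) {s : ℝ} (hs : s ∈ Set.Ioo (0 : ℝ) 1) :
    AffineMap.lineMap p q s ∈ halfHorocycle S p ↔ s = 1 / (1 + dist p q ^ 2) := by
  have hL : 0 < dist p q := dist_pos.2 hpq
  have hs0 : 0 < s := hs.1
  have hs1 : 0 < 1 - s := sub_pos.2 hs.2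
  have hN : S.radius ^ 2 - inner ℝ (AffineMap.lineMap p q s - S.center) (p - S.center) =
      dist p q ^ 2 / 2 * s := by
    have h := radius_sq_sub_inner_lineMap S hp hq s 0
    rw [AffineMap.lineMap_apply_zero] at h
    rw [h]
    ring
  have hpos : 0 < √(s * (1 - s)) := Real.sqrt_pos.2 (mul_pos hs0 hs1)
  have hB : expBusemann S p (AffineMap.lineMap p q s) = dist p q * s / √(s * (1 - s)) / 2 := by
    rw [expBusemann, hN, radius_sq_sub_norm_sq_lineMap S hp hq, Real.sqrt_mul (sq_nonneg _),
      Real.sqrt_sq hL.le]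
    field_simp
  rw [halfHorocycle, Set.mem_ofPred_eq, and_iff_right (lineMap_mem_kleinDisk S hp hq hpq hs), hB,
    div_left_inj' two_ne_zero, div_eq_one_iff_eq hpos.ne', eq_comm,
    Real.sqrt_eq_iff_mul_self_eq (by positivity) (by positivity), eq_div_iff (by positivity)]
  constructor
  · intro h
    have : s * (s * (1 + dist p q ^ 2)) = s * 1 := by linarith
    exact mul_left_cancel₀ hs0.ne' this
  · intro h
    linear_combination (-s) * h

theorem one_div_one_add_sq_mem_Ioo {L : ℝ} (hL : 0 < L) : 1 / (1 + L ^ 2) ∈ Set.Ioo (0 : ℝ) 1 :=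
  ⟨by positivity, (div_lt_one (by positivity)).2 (lt_add_of_pos_right _ (by positivity))⟩

theorem halfHorocycle_inter_openSegment (S : Circ) {p q : Plane} (hp : p ∈ S) (hq : q ∈ S)
    (hpq : p ≠ q) :
    halfHorocycle S p ∩ openSegment ℝ p q =
      {AffineMap.lineMap p q (1 / (1 + dist p q ^ 2))} := by
  have h0 := one_div_one_add_sq_mem_Ioo (dist_pos.2 hpq)
  ext x
  rw [Set.mem_singleton_iff]
  constructor
  · rintro ⟨hx, hx'⟩
    obtain ⟨s, hs, rfl⟩ := mem_openSegment_iff_lineMap.1 hx'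
    rw [(lineMap_mem_halfHorocycle_iff S hp hq hpq hs).1 hx]
  · rintro rfl
    exact ⟨(lineMap_mem_halfHorocycle_iff S hp hq hpq h0).2 rfl,
      mem_openSegment_iff_lineMap.2 ⟨_, h0, rfl⟩⟩

theorem isHorocycle_halfHorocycle (S : Circ) {p q : Plane} (hp : p ∈ S) (hq : q ∈ S)
    (hpq : p ≠ q) : IsHorocycle S p (halfHorocycle S p) := by
  have h0 := one_div_one_add_sq_mem_Ioo (dist_pos.2 hpq)
  have hx := (lineMap_mem_halfHorocycle_iff S hp hq hpq h0).2 rfl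
  exact ⟨_, hx.1, by rw [horocycle_eq hp hx.1, hx.2, halfHorocycle]⟩

/-- The signed distance between the horocycles of level `1/2` at the ends of the chord `pq`. -/
theorem signedKleinDist_halfHorocycle (S : Circ) {p q : Plane} (hp : p ∈ S) (hq : q ∈ S)
    (hpq : p ≠ q) :
    signedKleinDist S p (AffineMap.lineMap p q (1 / (1 + dist p q ^ 2)))
      (AffineMap.lineMap q p (1 / (1 + dist p q ^ 2))) = 2 * Real.log (dist p q) := by
  have hL : 0 < dist p q := dist_pos.2 hpq
  have h0 := one_div_one_add_sq_mem_Ioo hL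
  rw [← AffineMap.lineMap_apply_one_sub p q, signedKleinDist_lineMap_eq_log S hp hq hpq h0
    ⟨sub_pos.2 h0.2, sub_lt_self _ h0.1⟩]
  have e1 : (1 - 1 / (1 + dist p q ^ 2)) / (1 - (1 - 1 / (1 + dist p q ^ 2))) = dist p q ^ 2 := by
    field_simp
    ring
  have e2 : 1 / (1 + dist p q ^ 2) / (1 - 1 / (1 + dist p q ^ 2)) = (dist p q ^ 2)⁻¹ := by
    have : 1 - 1 / (1 + dist p q ^ 2) = dist p q ^ 2 / (1 + dist p q ^ 2) := by
      field_simp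
      ring
    rw [this]
    field_simp
  rw [e1, e2, Real.log_inv, Real.log_pow]
  push_cast
  ring

/-! ### The ideal triangulation induced by a euclidean triangulation -/

namespace SurfaceTriangulation

theorem ne_of_mem_triangles {V : Type*} [DecidableEq V] (T : SurfaceTriangulation V) {i j k : V}
    (h : {i, j, k} ∈ T.triangles) : i ≠ j ∧ i ≠ k ∧ j ≠ k := by
  have h3 := T.card_eq _ h
  refine ⟨?_, ?_, ?_⟩ <;> rintro rfl
  · rw [Finset.insert_eq_of_mem (by simp)] at h3
    exact absurd h3 (Finset.card_le_two.trans_lt (by norm_num)).ne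
  · rw [Finset.insert_eq_of_mem (by simp)] at h3
    exact absurd h3 (Finset.card_le_two.trans_lt (by norm_num)).ne
  · rw [Finset.pair_eq_singleton] at h3
    exact absurd h3 (Finset.card_le_two.trans_lt (by norm_num)).ne

end SurfaceTriangulation

namespace DiscreteMetric.Layout

variable {V : Type*} [DecidableEq V] {T : SurfaceTriangulation V} {ℓ : DiscreteMetric T}

theorem isShear_iff (P : ℓ.Layout) {i j k l : V} (hk : {i, j, k} ∈ T.triangles)
    (hl : {i, l, j} ∈ T.triangles) (Z : ℝ) :
    P.idealTriangulation.IsShear i j k l hk hl Z ↔ Z = Real.log (ℓ.lcr i j k l) := by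
  obtain ⟨hij, hik, hjk⟩ := T.ne_of_mem_triangles hk
  obtain ⟨hil, -, hlj⟩ := T.ne_of_mem_triangles hl
  have mi : i ∈ ({i, j, k} : Finset V) := by simp
  have mj : j ∈ ({i, j, k} : Finset V) := by simp
  have mk : k ∈ ({i, j, k} : Finset V) := by simp
  have mi' : i ∈ ({i, l, j} : Finset V) := by simp
  have mj' : j ∈ ({i, l, j} : Finset V) := by simp
  have ml' : l ∈ ({i, l, j} : Finset V) := by simp
  set t : T.Face := ⟨_, hk⟩
  set t' : T.Face := ⟨_, hl⟩
  have hik0 := ℓ.len_pos _ hk i mi k mk hik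
  have hjk0 := ℓ.len_pos _ hk j mj k mk hjk
  have hil0 := ℓ.len_pos _ hl i mi' l ml' hil
  have hlj0 := ℓ.len_pos _ hl j mj' l ml' hlj.symm
  have foot_k : ∀ a, IsHeightFoot (P.circumcircle t) (P.pos t k) (P.pos t i) (P.pos t j) a ↔ _ :=
    fun a => isHeightFoot_iff (P.circumcircle t) (P.mem_circle t i mi) (P.mem_circle t j mj)
      (P.mem_circle t k mk) (P.pos_ne t mi mj hij) (P.pos_ne t mi mk hik) (P.pos_ne t mj mk hjk)
  have foot_l : ∀ b,
      IsHeightFoot (P.circumcircle t') (P.pos t' l) (P.pos t' i) (P.pos t' j) b ↔ _ :=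
    fun b => isHeightFoot_iff (P.circumcircle t') (P.mem_circle t' i mi') (P.mem_circle t' j mj')
      (P.mem_circle t' l ml') (P.pos_ne t' mi' mj' hij) (P.pos_ne t' mi' ml' hil)
      (P.pos_ne t' mj' ml' hlj.symm)
  rw [P.dist_eq t i mi k mk hik, P.dist_eq t j mj k mk hjk] at foot_k
  rw [P.dist_eq t' i mi' l ml' hil, P.dist_eq t' j mj' l ml' hlj.symm] at foot_l
  have ratio : ∀ x y : ℝ, 0 < x → 0 < y → x ^ 2 / (x ^ 2 + y ^ 2) ∈ Set.Ioo (0 : ℝ) 1 ∧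
      Real.log (x ^ 2 / (x ^ 2 + y ^ 2) / (1 - x ^ 2 / (x ^ 2 + y ^ 2))) =
        2 * (Real.log x - Real.log y) := by
    intro x y hx hy
    refine ⟨⟨by positivity,
      (div_lt_one (by positivity)).2 (lt_add_of_pos_right _ (by positivity))⟩, ?_⟩
    have e : 1 - x ^ 2 / (x ^ 2 + y ^ 2) = y ^ 2 / (x ^ 2 + y ^ 2) := by
      field_simp
      ring
    rw [e, div_div_div_cancel_right₀ (by positivity), Real.log_div (by positivity) (by positivity),
      Real.log_pow, Real.log_pow]
    push_cast
    ring
  obtain ⟨hs, es⟩ := ratio _ _ hik0 hjk0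
  obtain ⟨hr, er⟩ := ratio _ _ hil0 hlj0
  have value : signedKleinDist (P.circumcircle t) (P.pos t i)
      (AffineMap.lineMap (P.pos t i) (P.pos t j)
        (ℓ.len s(i, k) ^ 2 / (ℓ.len s(i, k) ^ 2 + ℓ.len s(j, k) ^ 2)))
      (P.idealTriangulation.glue t' t i j (AffineMap.lineMap (P.pos t' i) (P.pos t' j)
        (ℓ.len s(i, l) ^ 2 / (ℓ.len s(i, l) ^ 2 + ℓ.len s(j, l) ^ 2)))) =
      Real.log (ℓ.lcr i j k l) := by
    change signedKleinDist _ _ _ (edgeMap (P.pos t' i) (P.pos t' j) (P.pos t i) (P.pos t j) _) = _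
    rw [edgeMap_lineMap (P.pos_ne t' mi' mj' hij) _ _ hr.1.le,
      signedKleinDist_lineMap_eq_log _ (P.mem_circle t i mi) (P.mem_circle t j mj)
        (P.pos_ne t mi mj hij) hs hr, es, er, DiscreteMetric.lcr, Sym2.eq_swap (a := k) (b := i),
      Sym2.eq_swap (a := l) (b := j),
      Real.log_div (by positivity) (by positivity), Real.log_mul hil0.ne' hjk0.ne',
      Real.log_mul hlj0.ne' hik0.ne']
    ring
  constructor
  · rintro ⟨a, b, ha, hb, rfl⟩
    rw [(foot_k a).1 ha, (foot_l b).1 hb]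
    exact value
  · rintro rfl
    exact ⟨_, _, (foot_k _).2 rfl, (foot_l _).2 rfl, value.symm⟩

theorem halfHorocycle_inter_side (P : ℓ.Layout) (t : T.Face) {i j : V} (hi : i ∈ t.1)
    (hj : j ∈ t.1) (hij : i ≠ j) :
    halfHorocycle (P.circumcircle t) (P.pos t i) ∩ P.idealTriangulation.side t i j =
      {AffineMap.lineMap (P.pos t i) (P.pos t j) (1 / (1 + ℓ.len s(i, j) ^ 2))} := by
  rw [← P.dist_eq t i hi j hj hij]
  exact halfHorocycle_inter_openSegment _ (P.mem_circle t i hi) (P.mem_circle t j hj)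
    (P.pos_ne t hi hj hij)

/-- The decoration by the horocycles of level `1/2`. -/
noncomputable def decoration (P : ℓ.Layout) : P.idealTriangulation.Decoration where
  horo t i := halfHorocycle (P.circumcircle t) (P.pos t i)
  isHorocycle t i hi := by
    -- another vertex of the triangle supplies a chord, hence a point of the horocycle
    obtain ⟨j, hj, hji⟩ := Finset.exists_mem_ne (by rw [T.card_eq t.1 t.2]; norm_num) i
    exact isHorocycle_halfHorocycle _ (P.mem_circle t i hi) (P.mem_circle t j hj)
      (P.pos_ne t hi hj hji.symm)
  fits t t' _ i hi j hj hij := by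
    rw [Finset.mem_inter] at hi hj
    rw [P.halfHorocycle_inter_side t hi.1 hj.1 hij, P.halfHorocycle_inter_side t' hi.2 hj.2 hij,
      Set.image_singleton]
    exact congrArg _ (edgeMap_lineMap (P.pos_ne t hi.1 hj.1 hij) _ _ (by positivity))

theorem decoration_isPenner_iff (P : ℓ.Layout) (t : T.Face) {i j : V} (hi : i ∈ t.1)
    (hj : j ∈ t.1) (hij : i ≠ j) (μ : ℝ) :
    P.decoration.IsPenner t i j μ ↔ μ = 2 * Real.log (ℓ.len s(i, j)) := by
  have hside : P.idealTriangulation.side t i j = P.idealTriangulation.side t j i :=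
    openSegment_symm ℝ _ _
  have h1 : P.decoration.horo t i ∩ P.idealTriangulation.side t i j = _ :=
    P.halfHorocycle_inter_side t hi hj hij
  have h2 : P.decoration.horo t j ∩ P.idealTriangulation.side t j i = _ :=
    P.halfHorocycle_inter_side t hj hi hij.symm
  have h3 := signedKleinDist_halfHorocycle _ (P.mem_circle t i hi) (P.mem_circle t j hj)
    (P.pos_ne t hi hj hij)
  rw [P.dist_eq t i hi j hj hij] at h3
  rw [Sym2.eq_swap] at h2
  unfold IdealTriangulation.Decoration.IsPenner
  rw [h1, hside, h2]
  simp only [Set.mem_singleton_iff, exists_eq_left]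
  exact Eq.congr_right h3

end DiscreteMetric.Layout

theorem mainTheorem9 {V : Type*} [DecidableEq V] (T : SurfaceTriangulation V)
    (ℓ : DiscreteMetric T) (P : ℓ.Layout) :
    (∀ (i j k l : V) (hk : {i, j, k} ∈ T.triangles) (hl : {i, l, j} ∈ T.triangles), k ≠ l →
      ∀ Z : ℝ, P.idealTriangulation.IsShear i j k l hk hl Z ↔ Z = Real.log (ℓ.lcr i j k l)) ∧
    ∃ D : P.idealTriangulation.Decoration,
      ∀ (t : T.Face) (i j : V), i ∈ t.1 → j ∈ t.1 → i ≠ j →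
        ∀ μ : ℝ, D.IsPenner t i j μ ↔ μ = 2 * Real.log (ℓ.len s(i, j)) :=
  ⟨fun _ _ _ _ hk hl _ Z => P.isShear_iff hk hl Z,
    P.decoration, fun t _ _ hi hj hij μ => P.decoration_isPenner_iff t hi hj hij μ⟩
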